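/- Let $D$ be a strongly connected digraph with a countable (finite or infinite) vertex set; loops are allowed, multiple arcs are not. Cycles are directed cycles without repeated vertices, and a loop is a cycle of length one. A set $T$ of vertices is a cycle transversal of $D$ if deleting the vertices of $T$ (with all incident arcs) leaves a digraph without cycles. A truthly substochastic weighting of $D$ is a function $S$ assigning a positive weight to each arc such that the sum of the weights of the arcs leaving any vertex is at most $1$, and is strictly less than $1$ for at least one vertex. For a finite (not necessarily induced) subdigraph $F$ of $D$ containing at least one cycle, let $\ell_{\max}(F)$ be the length of a longest cycle of $F$, and let $\lambda_S(F)$ be the spectral radius (Perron root) of the weighted adjacency matrix of $F$, whose $(v,w)$ entry is the $S$-weight of $(v,w)$ if $(v,w)$ is an arc of $F$ and $0$ otherwise. Then $$\inf_{F}\ \ell_{\max}(F)\bigl(1-\lambda_S(F)\bigr)>0\quad\text{for every truthly substochastic weighting } S \text{ of } D$$ if and only if $D$ has a finite cycle transversal. Here the infimum is taken over all finite subdigraphs $F$ of $D$ that contain a cycle (an infimum over the empty family being $+\infty$); the same equivalence holds if the infimum is taken only over the strongly connected ones among them. -/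

import Mathlib

open scoped NNReal ENNReal

namespace Digraph

universe u

/-- A directed cycle of length `n + 1` in `D`, given by its distinct vertices
`c 0, …, c n` in cyclic order (addition in `Fin (n + 1)` wraps around).
A loop is a cycle of length one. -/
def IsDirCycle {V : Type u} (D : Digraph V) {n : ℕ} (c : Fin (n + 1) → V) : Prop :=
  Function.Injective c ∧ ∀ i, D.Adj (c i) (c (i + 1))

/-- `D` has no directed cycles at all. -/
def Acyclic {V : Type u} (D : Digraph V) : Prop :=
  ∀ (n : ℕ) (c : Fin (n + 1) → V), ¬ D.IsDirCycle c

/-- The set of lengths of the directed cycles of `D`. -/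
def cycleLengths {V : Type u} (D : Digraph V) : Set ℕ :=
  {l | ∃ (n : ℕ) (c : Fin (n + 1) → V), D.IsDirCycle c ∧ l = n + 1}

/-- The length of a longest directed cycle of `D`; used only for finite digraphs that
have a cycle, where the set of cycle lengths is nonempty and bounded. -/
noncomputable def maxCycleLength {V : Type u} (D : Digraph V) : ℕ :=
  sSup D.cycleLengths

/-- Strong connectedness: any vertex is joined to any other one by a directed path. -/
def Strong {V : Type u} (D : Digraph V) : Prop :=
  ∀ v w : V, v ≠ w → Relation.ReflTransGen D.Adj v w

/-- The digraph obtained by deleting the vertices in `T` and all arcs incident to them. -/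
def deleteVertices {V : Type u} (D : Digraph V) (T : Set V) : Digraph {v : V // v ∉ T} where
  Adj v w := D.Adj v w

/-- A vertex set whose deletion leaves no directed cycle. -/
def IsCycleTransversal {V : Type u} (D : Digraph V) (T : Set V) : Prop :=
  (D.deleteVertices T).Acyclic

/-- A weighting of `D`: a positive function on the arcs, extended by `0` to all other
ordered pairs of vertices. -/
structure Weighting {V : Type u} (D : Digraph V) where
  weight : V → V → ℝ≥0
  pos_iff : ∀ v w, 0 < weight v w ↔ D.Adj v w

namespace Weighting

variable {V : Type u} {D : Digraph V}

/-- The sum of the weights of the arcs leaving `v`. -/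
noncomputable def outWeight (W : D.Weighting) (v : V) : ℝ≥0∞ :=
  ∑' w, (W.weight v w : ℝ≥0∞)

def Substochastic (W : D.Weighting) : Prop :=
  ∀ v, W.outWeight v ≤ 1

/-- Substochastic, and some vertex has out-weight strictly less than `1`. -/
def TruthlySubstochastic (W : D.Weighting) : Prop :=
  W.Substochastic ∧ ∃ v, W.outWeight v < 1

/-- The weighted adjacency matrix, with entries regarded as complex numbers. -/
noncomputable def adjMatrix (W : D.Weighting) : Matrix V V ℂ :=
  Matrix.of fun v w => ((W.weight v w : ℝ) : ℂ)

open Classical in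
/-- The Perron root of a finite weighted digraph: the spectral radius (largest modulus of
a complex eigenvalue) of its weighted adjacency matrix. -/
noncomputable def perronRoot [Fintype V] (W : D.Weighting) : ℝ :=
  (spectralRadius ℂ W.adjMatrix).toReal

end Weighting

/-- A finite (not necessarily induced) subdigraph of `D`. -/
structure FiniteSubdigraph {V : Type u} (D : Digraph V) where
  verts : Finset V
  Adj : V → V → Prop
  adj_sub : ∀ {v w}, Adj v w → D.Adj v w
  left_mem : ∀ {v w}, Adj v w → v ∈ verts
  right_mem : ∀ {v w}, Adj v w → w ∈ verts

namespace FiniteSubdigraph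

variable {V : Type u} {D : Digraph V}

/-- A finite subdigraph as a digraph on its own vertex set. -/
def toDigraph (F : D.FiniteSubdigraph) : Digraph {v : V // v ∈ F.verts} where
  Adj v w := F.Adj v w

open Classical in
/-- The restriction of a weighting of `D` to the arcs of a finite subdigraph. -/
noncomputable def restrict (F : D.FiniteSubdigraph) (W : D.Weighting) :
    F.toDigraph.Weighting where
  weight v w := if F.Adj v w then W.weight v w else 0
  pos_iff v w := by
    by_cases h : F.Adj v w
    · simpa [h, toDigraph] using (W.pos_iff v w).2 (F.adj_sub h)
    · simp [h, toDigraph]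

/-- The quantity `ℓ_max(F) (1 - λ_S(F))`. -/
noncomputable def gap (F : D.FiniteSubdigraph) (S : D.Weighting) : ℝ :=
  (F.toDigraph.maxCycleLength : ℝ) * (1 - (F.restrict S).perronRoot)

end FiniteSubdigraph

end Digraph

/-! Let `T` be a finite cycle transversal. By strong connectedness, walks from any vertex eventually
lose weight, so some `m` and `q < 1` bound the weight of the `m`-step walks from every vertex of
`T`, in `D` and hence in every finite `F`. An eigenvector of `F` for `μ` yields a nonnegative
subeigenvector supported on mutually reachable vertices (`exists_subeigenvector`). Within this
support every walk of `|T| ℓ + 1` steps meets `T`: closed up by a path, it splits into cycles that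
each meet `T` (`closed_chain_length_le`). Evaluating at a maximum gives `‖μ‖ ^ (|T| ℓ + 1 + m) ≤ q`,
and Bernoulli's inequality makes `ℓ (1 - ‖μ‖)` at least a constant independent of `F`.

Without a finite transversal, infinitely many disjoint cycles can be chosen greedily. Weights very
close to `1` on their arcs make the gaps of these cycles tend to `0`. -/

namespace Digraph

/-! ### Walks, cycles and transversals. -/

section Chains

variable {V : Type*}

theorem exists_append_of_not_nodup {l : List V} (h : ¬ l.Nodup) :
    ∃ x l₁ l₂ l₃, l = l₁ ++ x :: (l₂ ++ x :: l₃) := by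
  induction l with
  | nil => simp at h
  | cons a l ih =>
    by_cases ha : a ∈ l
    · obtain ⟨s, t, rfl⟩ := List.mem_iff_append.1 ha
      exact ⟨a, [], s, t, rfl⟩
    · obtain ⟨x, l₁, l₂, l₃, rfl⟩ := ih fun hl => h (List.nodup_cons.2 ⟨ha, hl⟩)
      exact ⟨x, a :: l₁, l₂, l₃, rfl⟩

/-- A walk can be shortened to a path with the same end vertices. -/
theorem exists_nodup_chain {R : V → V → Prop} {a b : V} (h : Relation.ReflTransGen R a b) :
    ∃ p : List V, List.IsChain R (a :: p) ∧ (a :: p).getLast? = some b ∧ p.Nodup := by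
  obtain ⟨p, hp, hlast⟩ := List.exists_isChain_cons_of_relationReflTransGen h
  replace hlast : (a :: p).getLast? = some b := by
    rw [← hlast, List.getLast?_eq_getLast_of_ne_nil]
  induction hn : p.length using Nat.strong_induction_on generalizing p with
  | _ n ih =>
    by_cases hd : p.Nodup
    -- Only `p` is free of repetitions; the start `a` may recur in it.
    · exact ⟨p, hp, hlast, hd⟩
    · obtain ⟨x, l₁, l₂, l₃, rfl⟩ := exists_append_of_not_nodup hd
      have h₁ := List.isChain_cons_split.1 hp
      have h₂ := List.isChain_cons_split.1 h₁.2
      refine ih _ ?_ (l₁ ++ x :: l₃) (List.isChain_cons_split.2 ⟨h₁.1, h₂.2⟩) ?_ rfl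
      · subst hn
        simp only [List.length_append, List.length_cons]
        omega
      · simpa [List.getLast?_cons, List.getLast?_append] using hlast

/-- Every walk along `R` with `n` steps starting at the given vertex meets `T`. -/
def HitsWithin (R : V → V → Prop) (T : Set V) : ℕ → V → Prop
  | 0, v => v ∈ T
  | n + 1, v => v ∈ T ∨ ∀ w, R v w → HitsWithin R T n w

theorem exists_chain_of_not_hitsWithin {R : V → V → Prop} {T : Set V} {n : ℕ} {v : V}
    (h : ¬ HitsWithin R T n v) :
    ∃ p : List V, p.length = n ∧ List.IsChain R (v :: p) ∧ ∀ u ∈ p, u ∉ T := by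
  have key : v ∉ T ∧ ∃ p : List V, p.length = n ∧ List.IsChain R (v :: p) ∧ ∀ u ∈ p, u ∉ T := by
    induction n generalizing v with
    | zero => exact ⟨h, [], rfl, by simp, by simp⟩
    | succ n ih =>
      simp only [HitsWithin, not_or, not_forall] at h
      obtain ⟨hv, w, hw, hn⟩ := h
      obtain ⟨hwT, p, hp, hc, hT⟩ := ih hn
      refine ⟨hv, w :: p, by simp [hp], List.isChain_cons_cons.2 ⟨hw, hc⟩, ?_⟩
      simpa using ⟨hwT, hT⟩
  exact key.2

end Chains

section MaxCycleLength

variable {V : Type*} {D : Digraph V}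

theorem IsDirCycle.length_le_card [Fintype V] {n : ℕ} {c : Fin (n + 1) → V}
    (hc : D.IsDirCycle c) : n + 1 ≤ Fintype.card V := by
  simpa using Fintype.card_le_of_injective c hc.1

theorem IsDirCycle.length_le_maxCycleLength [Fintype V] {n : ℕ} {c : Fin (n + 1) → V}
    (hc : D.IsDirCycle c) : n + 1 ≤ D.maxCycleLength := by
  refine le_csSup ⟨Fintype.card V, ?_⟩ ⟨n, c, hc, rfl⟩
  rintro _ ⟨m, d, hd, rfl⟩
  exact hd.length_le_card

theorem one_le_maxCycleLength [Fintype V] (h : ¬ D.Acyclic) : 1 ≤ D.maxCycleLength := by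
  simp only [Acyclic, not_forall, not_not] at h
  obtain ⟨n, c, hc⟩ := h
  exact le_trans (by omega) hc.length_le_maxCycleLength

theorem maxCycleLength_le_card [Fintype V] : D.maxCycleLength ≤ Fintype.card V := by
  refine csSup_le' ?_
  rintro _ ⟨m, d, hd, rfl⟩
  exact hd.length_le_card

/-- A closed walk without repeated vertices is a directed cycle. -/
theorem isDirCycle_of_closed_chain {a : V} {p : List V} {n : ℕ} (hn : p.length = n + 1)
    (hp : List.IsChain D.Adj (a :: p)) (hlast : (a :: p).getLast? = some a) (hd : p.Nodup) :
    D.IsDirCycle fun i : Fin (n + 1) => p[(i : ℕ)]'(by omega) := by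
  refine ⟨fun i j hij => Fin.ext ((List.Nodup.getElem_inj_iff hd).1 hij), fun i => ?_⟩
  rw [List.isChain_iff_getElem] at hp
  rcases Fin.eq_castSucc_or_eq_last i with ⟨j, rfl⟩ | rfl
  · have := hp (j + 1) (by simp [hn])
    simpa [Fin.val_add_one] using this
  · have h0 := hp 0 (by simp [hn])
    have hl : p[n] = a := by
      have : (a :: p)[n + 1]? = some a := by
        rw [List.getLast?_eq_getElem?] at hlast
        simpa [hn] using hlast
      simpa [List.getElem?_eq_some_iff, hn] using this
    simpa [hl] using h0

open Classical in
/-- If `T` meets all cycles, a closed walk that visits `T` at most `r` times is at most `r` times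
as long as a longest cycle. -/
theorem closed_chain_length_le [Fintype V] {T : Set V} (hT : D.IsCycleTransversal T) {a : V}
    {p : List V} (hp : List.IsChain D.Adj (a :: p)) (hlast : (a :: p).getLast? = some a) :
    p.length ≤ p.countP (· ∈ T) * D.maxCycleLength := by
  induction hn : p.length using Nat.strong_induction_on generalizing a p with
  | _ n ih =>
    by_cases hd : p.Nodup
    · rcases n with _ | n
      · simp
      have hc := isDirCycle_of_closed_chain hn hp hlast hd
      have hpos : 0 < p.countP (· ∈ T) := by
        by_contra hcon
        have hcon : ∀ u ∈ p, u ∉ T := by simpa [List.countP_eq_zero] using hcon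
        refine hT n (fun i => ⟨p[(i : ℕ)]'(by omega), hcon _ (List.getElem_mem _)⟩) ⟨?_, hc.2⟩
        intro i j hij
        exact hc.1 (congrArg Subtype.val hij)
      exact hc.length_le_maxCycleLength.trans (Nat.le_mul_of_pos_left _ hpos)
    · obtain ⟨x, l₁, l₂, l₃, rfl⟩ := exists_append_of_not_nodup hd
      have h₁ := List.isChain_cons_split.1 hp
      have h₂ := List.isChain_cons_split.1 h₁.2
      subst hn
      -- A repeated vertex splits the walk into two shorter closed walks. Lengths and visits to `T`
      -- add up, as the list omits the starting vertex.
      have e₁ := ih (l₂ ++ [x]).length (by simp; omega) h₂.1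
        (by simp [List.getLast?_cons, List.getLast?_append]) rfl
      have e₂ := ih (l₁ ++ x :: l₃).length (by simp)
        (List.isChain_cons_split.2 ⟨h₁.1, h₂.2⟩)
        (by simpa [List.getLast?_cons, List.getLast?_append] using hlast) rfl
      simp only [List.length_append, List.length_cons, List.countP_append, List.countP_cons,
        List.length_nil, List.countP_nil] at e₁ e₂ ⊢
      linarith [e₁, e₂]

open Classical in
theorem countP_mem_le_ncard [Finite V] {p : List V} (hp : p.Nodup) (T : Set V) :
    p.countP (· ∈ T) ≤ T.ncard := by
  rw [List.countP_eq_length_filter, ← List.toFinset_card_of_nodup (hp.filter _),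
    ← Set.ncard_coe_finset]
  exact Set.ncard_le_ncard (fun x hx => by simpa using (by simpa using hx : _ ∧ _).2)

/-- Walks through vertices that reach each other cannot avoid a cycle transversal for long. -/
theorem hitsWithin_of_isCycleTransversal [Fintype V] {T : Set V} (hT : D.IsCycleTransversal T)
    {C : Set V} (hC : ∀ u ∈ C, ∀ w ∈ C, Relation.ReflTransGen D.Adj u w) {v : V} (hv : v ∈ C) :
    HitsWithin (fun u w => D.Adj u w ∧ w ∈ C) T (T.ncard * D.maxCycleLength + 1) v := by
  classical
  by_contra h
  obtain ⟨p, hpl, hp, hpT⟩ := exists_chain_of_not_hitsWithin h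
  have hmem : ∀ u ∈ p, u ∈ C := by
    intro u hu
    obtain ⟨i, hi, rfl⟩ := List.getElem_of_mem hu
    exact ((List.isChain_iff_getElem.1 hp) i (by simpa using hi)).2
  have hne : p ≠ [] := by
    rintro rfl
    simp at hpl
  -- The return path `q` makes all the visits to `T`, at most `|T|`, so the closed walk has length
  -- at most `|T| ℓ`; but `p` alone is longer.
  obtain ⟨q, hq, hql, hqd⟩ := exists_nodup_chain (hC _ (hmem _ (List.getLast_mem hne)) v hv)
  have hchain : List.IsChain D.Adj (v :: (p ++ q)) := by
    rw [← List.dropLast_append_getLast hne, List.append_assoc, List.singleton_append,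
      List.isChain_cons_split, List.dropLast_append_getLast hne]
    exact ⟨hp.imp fun _ _ h => h.1, hq⟩
  have hlast : (v :: (p ++ q)).getLast? = some v := by
    rw [← List.dropLast_append_getLast hne, List.append_assoc, List.singleton_append,
      ← List.cons_append, List.getLast?_append, hql]
    rfl
  have hlen := closed_chain_length_le hT hchain hlast
  have h0 : p.countP (· ∈ T) = 0 := by simpa [List.countP_eq_zero] using hpT
  rw [List.countP_append, h0, zero_add, List.length_append, hpl] at hlen
  have := Nat.mul_le_mul_right D.maxCycleLength (countP_mem_le_ncard hqd T)
  omega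

end MaxCycleLength

end Digraph

namespace Digraph

namespace Weighting

/-! ### Perron roots and subeigenvectors. -/

section PerronRoot

variable {V : Type*} [Fintype V] {D : Digraph V} (W : D.Weighting)

open Classical in
theorem mem_spectrum_adjMatrix_iff {μ : ℂ} :
    μ ∈ spectrum ℂ W.adjMatrix ↔ ∃ x : V → ℂ, x ≠ 0 ∧ W.adjMatrix.mulVec x = μ • x := by
  rw [← Matrix.spectrum_toLin', ← Module.End.hasEigenvalue_iff_mem_spectrum]
  constructor
  · intro h
    obtain ⟨x, hx⟩ := h.exists_hasEigenvector
    exact ⟨x, hx.2, by simpa using hx.apply_eq_smul⟩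
  · rintro ⟨x, hx, h⟩
    exact Module.End.hasEigenvalue_of_hasEigenvector (x := x)
      (Module.End.hasEigenvector_iff.2 ⟨Module.End.mem_eigenspace_iff.2 (by simpa using h), hx⟩)

theorem perronRoot_le {r : ℝ} (hr : 0 ≤ r)
    (h : ∀ (μ : ℂ) (x : V → ℂ), x ≠ 0 → W.adjMatrix.mulVec x = μ • x → ‖μ‖ ≤ r) :
    W.perronRoot ≤ r := by
  classical
  refine ENNReal.toReal_le_of_le_ofReal hr (iSup₂_le fun μ hμ => ?_)
  obtain ⟨x, hx, hμx⟩ := W.mem_spectrum_adjMatrix_iff.1 (by convert hμ)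
  rw [← enorm_eq_nnnorm, ← ofReal_norm]
  exact ENNReal.ofReal_le_ofReal (h μ x hx hμx)

theorem le_perronRoot {μ : ℂ} {x : V → ℂ} (hx : x ≠ 0) (h : W.adjMatrix.mulVec x = μ • x) :
    ‖μ‖ ≤ W.perronRoot := by
  classical
  have hμ : μ ∈ spectrum ℂ W.adjMatrix := W.mem_spectrum_adjMatrix_iff.2 ⟨x, hx, h⟩
  -- Needed because `toReal` sends `⊤` to `0`.
  have hfin : spectralRadius ℂ W.adjMatrix ≠ ⊤ := by
    obtain ⟨B, hB⟩ := ((Matrix.finite_spectrum W.adjMatrix).image (‖·‖₊)).bddAbove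
    refine ne_top_of_le_ne_top (b := (B : ℝ≥0∞)) ENNReal.coe_ne_top (iSup₂_le fun k hk => ?_)
    exact ENNReal.coe_le_coe.2 (hB ⟨k, hk, rfl⟩)
  have hle : (‖μ‖₊ : ℝ≥0∞) ≤ spectralRadius ℂ W.adjMatrix :=
    le_iSup₂ (f := fun (k : ℂ) (_ : k ∈ spectrum ℂ W.adjMatrix) => (‖k‖₊ : ℝ≥0∞)) μ hμ
  have := ENNReal.toReal_mono hfin hle
  rw [ENNReal.coe_toReal, coe_nnnorm] at this
  unfold perronRoot
  convert this

/-- An eigenvector gives rise to a nonnegative subeigenvector supported on vertices that reach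
each other. -/
theorem exists_subeigenvector {μ : ℂ} {x : V → ℂ} (hx : x ≠ 0)
    (h : W.adjMatrix.mulVec x = μ • x) :
    ∃ y : V → ℝ, (∀ v, 0 ≤ y v) ∧ (∃ v, y v ≠ 0) ∧
      (∀ v, ‖μ‖ * y v ≤ ∑ w, (W.weight v w : ℝ) * y w) ∧
      ∀ u w, y u ≠ 0 → y w ≠ 0 → Relation.ReflTransGen D.Adj u w := by
  classical
  let reach : V → Finset V := fun v => {w | Relation.ReflTransGen D.Adj v w}
  have hsupp : (Finset.univ.filter fun v => x v ≠ 0).Nonempty := by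
    obtain ⟨v, hv⟩ := Function.ne_iff.1 hx
    exact ⟨v, by simpa using hv⟩
  -- By minimality, support vertices reachable from `v` reach `v` back.
  obtain ⟨v, hv, hmin⟩ := Finset.exists_min_image _ (fun v => (reach v).card) hsupp
  simp only [Finset.mem_filter, Finset.mem_univ, true_and] at hv hmin
  have hback : ∀ w, Relation.ReflTransGen D.Adj v w → x w ≠ 0 →
      Relation.ReflTransGen D.Adj w v := by
    intro w hvw hw
    have hsub : reach w ⊆ reach v := by
      intro z hz
      simp only [reach, Finset.mem_filter, Finset.mem_univ, true_and] at hz ⊢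
      exact hvw.trans hz
    have : v ∈ reach w := by
      rw [Finset.eq_of_subset_of_card_le hsub (hmin w hw)]
      simp [reach, Relation.ReflTransGen.refl]
    simpa [reach] using this
  refine ⟨fun u => if Relation.ReflTransGen D.Adj v u then ‖x u‖ else 0, ?_, ⟨v, ?_⟩, ?_, ?_⟩
  · intro u
    dsimp only
    split_ifs <;> positivity
  · simpa [Relation.ReflTransGen.refl] using hv
  · intro u
    dsimp only
    split_ifs with hu
    · have e : μ * x u = ∑ w, ((W.weight u w : ℝ) : ℂ) * x w := by
        have := congrFun h u
        simp only [Matrix.mulVec, dotProduct, adjMatrix, Matrix.of_apply, Pi.smul_apply,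
          smul_eq_mul] at this
        exact this.symm
      rw [← norm_mul, e]
      refine (norm_sum_le _ _).trans (Finset.sum_le_sum fun w _ => ?_)
      rw [norm_mul, Complex.norm_real, Real.norm_of_nonneg (NNReal.coe_nonneg _)]
      by_cases hw : D.Adj u w
      · rw [if_pos (hu.tail hw)]
      · have : W.weight u w = 0 := by
          simpa using mt (W.pos_iff u w).1 hw
        simp [this]
    · rw [mul_zero]
      refine Finset.sum_nonneg fun w _ => mul_nonneg (NNReal.coe_nonneg _) ?_
      split_ifs <;> positivity
  · intro u w hu hw
    dsimp only at hu hw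
    split_ifs at hu hw with h₁ h₂
    · exact (hback u h₁ (by simpa using hu)).trans h₂
    all_goals simp_all

end PerronRoot

/-! ### Loss of weight along walks. -/

section Survival

variable {V : Type*} {D : Digraph V}

/-- The total weight of the walks with `n` steps starting at `v`. -/
noncomputable def survival (W : D.Weighting) : ℕ → V → ℝ≥0∞
  | 0, _ => 1
  | n + 1, v => ∑' w, (W.weight v w : ℝ≥0∞) * W.survival n w

theorem survival_le_one {W : D.Weighting} (hW : W.Substochastic) (n : ℕ) (v : V) :
    W.survival n v ≤ 1 := by
  induction n generalizing v with
  | zero => exact le_rfl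
  | succ n ih =>
    refine le_trans (ENNReal.tsum_le_tsum fun w => ?_) (hW v)
    exact mul_le_of_le_one_right' (ih w)

theorem survival_antitone {W : D.Weighting} (hW : W.Substochastic) (v : V) :
    Antitone fun n => W.survival n v := by
  refine antitone_nat_of_succ_le fun n => ?_
  induction n generalizing v with
  | zero => exact survival_le_one hW 1 v
  | succ n ih => exact ENNReal.tsum_le_tsum fun w => mul_le_mul_right (ih w) _

/-- In a strong digraph, walks from any vertex lose weight under a truthly substochastic
weighting. -/
theorem TruthlySubstochastic.exists_survival_lt_one {W : D.Weighting}
    (hW : W.TruthlySubstochastic) (hD : D.Strong) (v : V) : ∃ n, W.survival n v < 1 := by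
  obtain ⟨hsub, z, hz⟩ := hW
  have hz1 : ∃ n, W.survival n z < 1 := ⟨1, by simpa [survival, outWeight] using hz⟩
  by_cases hvz : v = z
  · exact hvz ▸ hz1
  -- Loss at `z` propagates backwards along a path from `v`, each arc having positive weight.
  refine Relation.ReflTransGen.head_induction_on (hD v z hvz) hz1 ?_
  rintro a c hac - ⟨n, hn⟩
  refine ⟨n + 1, lt_of_lt_of_le ?_ (hsub a)⟩
  have hpos : (W.weight a c : ℝ≥0∞) ≠ 0 := by
    simpa using ((W.pos_iff a c).2 hac).ne'
  refine ENNReal.tsum_lt_tsum (i := c) ?_ (fun w => ?_) ?_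
  · exact ne_top_of_le_ne_top ENNReal.one_ne_top (survival_le_one hsub (n + 1) a)
  · exact mul_le_of_le_one_right' (survival_le_one hsub n w)
  · simpa using ENNReal.mul_lt_mul_right hpos ENNReal.coe_ne_top hn

/-- Survival decreases with the number of steps, so the largest of finitely many step counts serves
all of `T`. -/
theorem TruthlySubstochastic.exists_uniform_survival_le {W : D.Weighting}
    (hW : W.TruthlySubstochastic) (hD : D.Strong) {T : Set V} (hT : T.Finite) :
    ∃ (m : ℕ) (q : ℝ), 0 ≤ q ∧ q < 1 ∧ ∀ t ∈ T, W.survival m t ≤ ENNReal.ofReal q := by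
  choose n hn using hW.exists_survival_lt_one hD
  obtain ⟨m, hm⟩ := (hT.image n).bddAbove
  have hlt : ∀ t ∈ T, W.survival m t < 1 := fun t ht =>
    (survival_antitone hW.1 t (hm ⟨t, ht, rfl⟩)).trans_lt (hn t)
  refine ⟨m, (hT.toFinset.sup (W.survival m)).toReal, ENNReal.toReal_nonneg, ?_, ?_⟩
  · have : hT.toFinset.sup (W.survival m) < 1 := by
      rw [Finset.sup_lt_iff (by simp)]
      simpa using hlt
    rw [← ENNReal.toReal_one]
    exact (ENNReal.toReal_lt_toReal this.ne_top ENNReal.one_ne_top).2 this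
  · intro t ht
    rw [ENNReal.ofReal_toReal]
    · exact Finset.le_sup (f := W.survival m) (hT.mem_toFinset.2 ht)
    · have : hT.toFinset.sup (W.survival m) ≤ 1 :=
        Finset.sup_le fun t _ => survival_le_one hW.1 m t
      exact ne_top_of_le_ne_top ENNReal.one_ne_top this

end Survival

end Weighting

end Digraph

/-! ### Lower bound on the gap. -/

namespace Digraph

namespace Weighting

variable {V : Type*} [Fintype V] {D : Digraph V} {W : D.Weighting}

theorem Substochastic.sum_weight_le_one (hW : W.Substochastic) (v : V) :
    ∑ w, (W.weight v w : ℝ) ≤ 1 := by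
  have := hW v
  rw [outWeight, tsum_fintype] at this
  exact_mod_cast this

theorem Substochastic.toReal_survival_succ (hW : W.Substochastic) (n : ℕ) (v : V) :
    (W.survival (n + 1) v).toReal = ∑ w, (W.weight v w : ℝ) * (W.survival n w).toReal := by
  rw [survival, tsum_fintype, ENNReal.toReal_sum]
  · simp [ENNReal.toReal_mul]
  · intro w _
    exact ENNReal.mul_ne_top ENNReal.coe_ne_top
      (ne_top_of_le_ne_top ENNReal.one_ne_top (survival_le_one hW n w))

/-- If `T` is a cycle transversal from which walks with `m` steps have total weight at most `q`,
then the eigenvalues are bounded in terms of `q`, `m`, the size of `T` and the length of a longest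
cycle. -/
theorem Substochastic.norm_eigenvalue_pow_le (hW : W.Substochastic) {T : Set V}
    (hT : D.IsCycleTransversal T) {m : ℕ} {q : ℝ} (hq : 0 ≤ q)
    (hm : ∀ t ∈ T, W.survival m t ≤ ENNReal.ofReal q) {μ : ℂ} {x : V → ℂ} (hx : x ≠ 0)
    (h : W.adjMatrix.mulVec x = μ • x) :
    ‖μ‖ ≤ 1 ∧ ‖μ‖ ^ (T.ncard * D.maxCycleLength + 1 + m) ≤ q := by
  obtain ⟨y, hy0, ⟨v₀, hv₀⟩, hsub, hconn⟩ := W.exists_subeigenvector hx h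
  obtain ⟨z, -, hz⟩ := Finset.exists_max_image Finset.univ y ⟨v₀, Finset.mem_univ _⟩
  replace hz : ∀ v, y v ≤ y z := fun v => hz v (Finset.mem_univ v)
  have hzpos : 0 < y z := lt_of_lt_of_le (lt_of_le_of_ne (hy0 v₀) hv₀.symm) (hz v₀)
  -- One step of averaging: the weights leaving `v` sum to at most `1`.
  have hstep : ∀ (a B : ℝ) (v : V), 0 ≤ a → 0 ≤ B →
      (∀ w, D.Adj v w → a * y w ≤ B) → a * ‖μ‖ * y v ≤ B := by
    intro a B v ha hB hw
    calc a * ‖μ‖ * y v = a * (‖μ‖ * y v) := by ring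
      _ ≤ a * ∑ w, (W.weight v w : ℝ) * y w := mul_le_mul_of_nonneg_left (hsub v) ha
      _ = ∑ w, (W.weight v w : ℝ) * (a * y w) := by
        rw [Finset.mul_sum]
        exact Finset.sum_congr rfl fun w _ => by ring
      _ ≤ ∑ w, (W.weight v w : ℝ) * B := by
        refine Finset.sum_le_sum fun w _ => ?_
        by_cases hvw : D.Adj v w
        · exact mul_le_mul_of_nonneg_left (hw w hvw) (NNReal.coe_nonneg _)
        · have : W.weight v w = 0 := by simpa using mt (W.pos_iff v w).1 hvw
          simp [this]
      _ = (∑ w, (W.weight v w : ℝ)) * B := by rw [Finset.sum_mul]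
      _ ≤ B := mul_le_of_le_one_left hB (hW.sum_weight_le_one v)
  have hμ1 : ‖μ‖ ≤ 1 := by
    have := hstep 1 (y z) z zero_le_one hzpos.le fun w _ => by simpa using hz w
    rw [one_mul] at this
    exact le_of_mul_le_mul_right (by simpa using this) hzpos
  have hsurv : ∀ n v, ‖μ‖ ^ n * y v ≤ (W.survival n v).toReal * y z := by
    intro n
    induction n with
    | zero => simpa [survival] using hz
    | succ n ih =>
      intro v
      rw [hW.toReal_survival_succ]
      calc ‖μ‖ ^ (n + 1) * y v = ‖μ‖ ^ n * (‖μ‖ * y v) := by ring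
        _ ≤ ‖μ‖ ^ n * ∑ w, (W.weight v w : ℝ) * y w :=
          mul_le_mul_of_nonneg_left (hsub v) (by positivity)
        _ = ∑ w, (W.weight v w : ℝ) * (‖μ‖ ^ n * y w) := by
          rw [Finset.mul_sum]
          exact Finset.sum_congr rfl fun w _ => by ring
        _ ≤ ∑ w, (W.weight v w : ℝ) * ((W.survival n w).toReal * y z) :=
          Finset.sum_le_sum fun w _ => mul_le_mul_of_nonneg_left (ih w) (NNReal.coe_nonneg _)
        _ = (∑ w, (W.weight v w : ℝ) * (W.survival n w).toReal) * y z := by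
          rw [Finset.sum_mul]
          exact Finset.sum_congr rfl fun w _ => by ring
  have hmT : ∀ v ∈ T, ∀ j, ‖μ‖ ^ (j + m) * y v ≤ q * y z := by
    intro v hv j
    have h₁ : ‖μ‖ ^ (j + m) ≤ ‖μ‖ ^ m :=
      pow_le_pow_of_le_one (norm_nonneg _) hμ1 (Nat.le_add_left _ _)
    have h₂ : (W.survival m v).toReal ≤ q := ENNReal.toReal_le_of_le_ofReal hq (hm v hv)
    exact (mul_le_mul_of_nonneg_right h₁ (hy0 v)).trans
      ((hsurv m v).trans (mul_le_mul_of_nonneg_right h₂ hzpos.le))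
  -- Bounds on `T` are pulled back step by step; vertices off the support satisfy them trivially,
  -- since `y` vanishes there.
  have hhit : ∀ j v, HitsWithin (fun u w => D.Adj u w ∧ w ∈ {w | y w ≠ 0}) T j v →
      ‖μ‖ ^ (j + m) * y v ≤ q * y z := by
    intro j
    induction j with
    | zero => exact fun v hv => hmT v hv 0
    | succ j ih =>
      rintro v (hv | hv)
      · exact hmT v hv _
      · have hqz : 0 ≤ q * y z := mul_nonneg hq hzpos.le
        have := hstep (‖μ‖ ^ (j + m)) (q * y z) v (by positivity) hqz fun w hvw => by
          by_cases hw : y w = 0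
          · simpa [hw] using hqz
          · exact ih w (hv w ⟨hvw, hw⟩)
        rwa [← pow_succ, show j + m + 1 = j + 1 + m by omega] at this
  refine ⟨hμ1, le_of_mul_le_mul_right (hhit _ z ?_) hzpos⟩
  exact hitsWithin_of_isCycleTransversal hT (fun u hu w hw => hconn u w hu hw) hzpos.ne'

end Weighting

namespace FiniteSubdigraph

variable {V : Type*} {D : Digraph V} (F : D.FiniteSubdigraph)

theorem restrict_weight_le (S : D.Weighting) (v w : {v : V // v ∈ F.verts}) :
    (F.restrict S).weight v w ≤ S.weight v w := by
  simp only [restrict]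
  split_ifs <;> simp

theorem survival_restrict_le (S : D.Weighting) (n : ℕ) (v : {v : V // v ∈ F.verts}) :
    (F.restrict S).survival n v ≤ S.survival n v := by
  induction n generalizing v with
  | zero => exact le_rfl
  | succ n ih =>
    refine le_trans (ENNReal.tsum_le_tsum fun w => ?_) (ENNReal.tsum_comp_le_tsum_of_injective
      Subtype.val_injective fun w => (S.weight v w : ℝ≥0∞) * S.survival n w)
    exact mul_le_mul' (ENNReal.coe_le_coe.2 (F.restrict_weight_le S v w)) (ih w)

theorem substochastic_restrict {S : D.Weighting} (hS : S.Substochastic) :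
    (F.restrict S).Substochastic := by
  intro v
  refine le_trans (ENNReal.tsum_le_tsum fun w => ?_) (le_trans
    (ENNReal.tsum_comp_le_tsum_of_injective Subtype.val_injective
      fun w => (S.weight v w : ℝ≥0∞)) (hS v))
  exact ENNReal.coe_le_coe.2 (F.restrict_weight_le S v w)

theorem isCycleTransversal_preimage {T : Set V} (hT : D.IsCycleTransversal T) :
    F.toDigraph.IsCycleTransversal (Subtype.val ⁻¹' T) := by
  intro n c hc
  refine hT n (fun i => ⟨(c i).1.1, (c i).2⟩) ⟨fun i j hij => hc.1 ?_, fun i => F.adj_sub (hc.2 i)⟩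
  exact Subtype.ext (Subtype.ext (Subtype.mk.inj hij))

/-- A finite cycle transversal bounds the gaps of all finite subdigraphs with a cycle from below. -/
theorem exists_pos_le_gap {S : D.Weighting} (hS : S.TruthlySubstochastic) (hD : D.Strong)
    {T : Set V} (hTfin : T.Finite) (hT : D.IsCycleTransversal T) :
    ∃ c : ℝ, 0 < c ∧ ∀ F : D.FiniteSubdigraph, ¬ F.toDigraph.Acyclic → c ≤ F.gap S := by
  obtain ⟨m, q, hq0, hq1, hm⟩ := hS.exists_uniform_survival_le hD hTfin
  have hN : (0 : ℝ) < T.ncard + 1 + m := by positivity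
  refine ⟨(1 - q) / (T.ncard + 1 + m), div_pos (by linarith) hN, fun F hF => ?_⟩
  set ℓ := F.toDigraph.maxCycleLength with hℓ
  have hℓ1 : (1 : ℝ) ≤ ℓ := by exact_mod_cast one_le_maxCycleLength hF
  have hℓ0 : (0 : ℝ) < ℓ := by linarith
  have hroot : (F.restrict S).perronRoot ≤ 1 - (1 - q) / (T.ncard + 1 + m) / ℓ := by
    refine Weighting.perronRoot_le _ ?_ fun μ x hx hμ => ?_
    · rw [sub_nonneg, div_div, div_le_one (by positivity)]
      have : (1 : ℝ) ≤ T.ncard + 1 + m := by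
        have h₁ : (0 : ℝ) ≤ T.ncard := by positivity
        have h₂ : (0 : ℝ) ≤ m := by positivity
        linarith
      nlinarith
    · obtain ⟨hμ1, hpow⟩ := (F.substochastic_restrict hS.1).norm_eigenvalue_pow_le
        (F.isCycleTransversal_preimage hT) hq0
        (fun t ht => (F.survival_restrict_le S m t).trans (hm t ht)) hx hμ
      set k := (Subtype.val ⁻¹' T : Set {v : V // v ∈ F.verts}).ncard
      have hk : k ≤ T.ncard :=
        Set.ncard_le_ncard_of_injOn Subtype.val (fun _ h => h) Subtype.val_injective.injOn hTfin
      rw [← hℓ] at hpow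
      -- Bernoulli gives `1 - q ≤ (k ℓ + 1 + m) (1 - ‖μ‖)`; as `1 ≤ ℓ`, the first factor is at most
      -- `(|T| + 1 + m) ℓ`.
      have hbern := one_add_mul_le_pow (a := ‖μ‖ - 1) (by linarith [norm_nonneg μ])
        (k * ℓ + 1 + m)
      rw [add_sub_cancel] at hbern
      have hkr : (k : ℝ) ≤ T.ncard := by exact_mod_cast hk
      have hm0 : (0 : ℝ) ≤ m := by positivity
      have hle : ((k * ℓ + 1 + m : ℕ) : ℝ) ≤ (T.ncard + 1 + m) * ℓ := by
        push_cast
        nlinarith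
      have hmul := mul_le_mul_of_nonneg_right hle (sub_nonneg.2 hμ1)
      have : (1 - q) / (T.ncard + 1 + m) / ℓ ≤ 1 - ‖μ‖ := by
        rw [div_div, div_le_iff₀ (by positivity)]
        linarith
      linarith
  have := mul_le_mul_of_nonneg_left
    (show (1 - q) / (T.ncard + 1 + m) / ℓ ≤ 1 - (F.restrict S).perronRoot by linarith) hℓ0.le
  rwa [mul_div_cancel₀ _ hℓ0.ne'] at this

end FiniteSubdigraph

/-! ### Disjoint cycles with small gaps. -/

/-- A digraph without finite cycle transversal has infinitely many disjoint cycles. -/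
theorem exists_disjoint_cycles {V : Type*} {D : Digraph V}
    (h : ¬ ∃ T : Set V, T.Finite ∧ D.IsCycleTransversal T) :
    ∃ (n : ℕ → ℕ) (c : ∀ i, Fin (n i + 1) → V), (∀ i, D.IsDirCycle (c i)) ∧
      Function.Injective fun p : Σ i, Fin (n i + 1) => c p.1 p.2 := by
  let r : (Σ n, (Fin (n + 1) → V)) → (Σ n, (Fin (n + 1) → V)) → Prop :=
    fun a b => Disjoint (Set.range a.2) (Set.range b.2)
  have : Std.Symm r := ⟨fun a b hab => Disjoint.symm hab⟩
  obtain ⟨f, hf, hdisj⟩ := exists_seq_of_forall_finset_exists'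
    (fun a : Σ n, (Fin (n + 1) → V) => D.IsDirCycle a.2) r (fun s _ => by
      have hs : (⋃ a ∈ s, Set.range a.2 : Set V).Finite :=
        s.finite_toSet.biUnion fun a _ => Set.finite_range _
      -- The vertices of finitely many cycles form a finite set, so some cycle avoids them all.
      have hnot : ¬ D.IsCycleTransversal (⋃ a ∈ s, Set.range a.2 : Set V) :=
        fun hT => h ⟨_, hs, hT⟩
      simp only [IsCycleTransversal, Acyclic, not_forall, not_not] at hnot
      obtain ⟨n, c, hc⟩ := hnot
      refine ⟨⟨n, fun i => (c i).1⟩, ⟨Subtype.val_injective.comp hc.1, hc.2⟩, fun a ha => ?_⟩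
      refine Set.disjoint_right.2 ?_
      rintro _ ⟨i, rfl⟩ hi
      exact (c i).2 (Set.mem_biUnion ha hi))
  refine ⟨fun i => (f i).1, fun i => (f i).2, hf, ?_⟩
  rintro ⟨i, a⟩ ⟨j, b⟩ hab
  dsimp only at hab
  obtain rfl : i = j := by
    by_contra hij
    exact Set.disjoint_left.1 (hdisj hij) ⟨a, rfl⟩ ⟨b, hab.symm⟩
  rw [(hf i).1 hab]

/-- Given at most one preferred arc `(v, w)` at each vertex `v`, there is a truthly substochastic
weighting in which preferred arcs have prescribed weights `1 - d v` below `1`. -/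
theorem exists_weighting_of_preferred {V : Type*} [Countable V] [Nonempty V] {D : Digraph V}
    {N : V → V → Prop} (hN : ∀ v w, N v w → D.Adj v w) (huniq : ∀ v w w', N v w → N v w' → w = w')
    {d : V → ℝ≥0} (hd0 : ∀ v, 0 < d v) (hd1 : ∀ v, d v < 1) :
    ∃ S : D.Weighting, S.TruthlySubstochastic ∧ ∀ v w, N v w → S.weight v w = 1 - d v := by
  classical
  -- The other arcs at `v` share `d v` in proportions `e w` of total below `1`, so every vertex
  -- loses weight.
  obtain ⟨e, he0, he⟩ := ENNReal.exists_pos_sum_of_countable one_ne_zero V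
  let S : D.Weighting :=
    { weight := fun v w => if N v w then 1 - d v else if D.Adj v w then d v * e w else 0
      pos_iff := fun v w => by
        split_ifs with h₁ h₂
        · exact iff_of_true (tsub_pos_of_lt (hd1 v)) (hN v w h₁)
        · exact iff_of_true (mul_pos (hd0 v) (he0 w)) h₂
        · exact iff_of_false (lt_irrefl _) h₂ }
  have hlt : ∀ v, S.outWeight v < 1 := by
    intro v
    have h₁ : S.outWeight v ≤ ∑' w, ((if N v w then ((1 - d v : ℝ≥0) : ℝ≥0∞) else 0) +
        (d v : ℝ≥0∞) * e w) := by
      refine ENNReal.tsum_le_tsum fun w => ?_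
      simp only [S]
      split_ifs <;> simp
    have h₂ : ∑' w, (if N v w then ((1 - d v : ℝ≥0) : ℝ≥0∞) else 0) ≤ (1 - d v : ℝ≥0) := by
      by_cases hw : ∃ w, N v w
      · obtain ⟨w, hw⟩ := hw
        rw [tsum_eq_single w fun w' hw' => if_neg fun h => hw' (huniq v _ _ h hw), if_pos hw]
      · push Not at hw
        simp [hw]
    have h₃ : (d v : ℝ≥0∞) * ∑' w, (e w : ℝ≥0∞) < d v := by
      simpa using ENNReal.mul_lt_mul_right (by simpa using (hd0 v).ne') ENNReal.coe_ne_top he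
    rw [ENNReal.tsum_add, ENNReal.tsum_mul_left] at h₁
    calc S.outWeight v ≤ _ := h₁
      _ < (1 - d v : ℝ≥0) + d v :=
        ENNReal.add_lt_add_of_le_of_lt (ne_top_of_le_ne_top ENNReal.coe_ne_top h₂) h₂ h₃
      _ = 1 := by
        rw [← ENNReal.coe_add, tsub_add_cancel_of_le (hd1 v).le, ENNReal.coe_one]
  exact ⟨S, ⟨fun v => (hlt v).le, Classical.arbitrary V, hlt _⟩, fun v w h => if_pos h⟩

section CycleSubdigraph

variable {V : Type*} {D : Digraph V} {n : ℕ} {c : Fin (n + 1) → V}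

open Classical in
/-- A directed cycle as a finite subdigraph. -/
noncomputable def IsDirCycle.toSubdigraph (hc : D.IsDirCycle c) : D.FiniteSubdigraph where
  verts := Finset.univ.image c
  Adj v w := ∃ i, c i = v ∧ c (i + 1) = w
  adj_sub := by
    rintro _ _ ⟨i, rfl, rfl⟩
    exact hc.2 i
  left_mem := by
    rintro _ _ ⟨i, rfl, rfl⟩
    simp
  right_mem := by
    rintro _ _ ⟨i, rfl, rfl⟩
    simp

theorem IsDirCycle.mem_toSubdigraph (hc : D.IsDirCycle c) (i : Fin (n + 1)) :
    c i ∈ hc.toSubdigraph.verts := by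
  simp [toSubdigraph]

theorem IsDirCycle.not_acyclic_toSubdigraph (hc : D.IsDirCycle c) :
    ¬ hc.toSubdigraph.toDigraph.Acyclic := fun h =>
  h n (fun i => ⟨c i, hc.mem_toSubdigraph i⟩)
    ⟨fun _ _ hij => hc.1 (congrArg Subtype.val hij), fun i => ⟨i, rfl, rfl⟩⟩

theorem IsDirCycle.strong_toSubdigraph (hc : D.IsDirCycle c) :
    hc.toSubdigraph.toDigraph.Strong := by
  have key : ∀ i k : Fin (n + 1), Relation.ReflTransGen hc.toSubdigraph.toDigraph.Adj
      ⟨c i, hc.mem_toSubdigraph i⟩ ⟨c (i + k), hc.mem_toSubdigraph _⟩ := by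
    intro i k
    induction k using Fin.induction with
    | zero => simpa using Relation.ReflTransGen.refl
    | succ k ih => exact ih.tail ⟨i + k.castSucc, rfl, by rw [add_assoc, Fin.coeSucc_eq_succ]⟩
  rintro ⟨v, hv⟩ ⟨w, hw⟩ -
  obtain ⟨i, rfl⟩ : ∃ i, c i = v := by simpa [toSubdigraph] using hv
  obtain ⟨j, rfl⟩ : ∃ j, c j = w := by simpa [toSubdigraph] using hw
  simpa using key i (j - i)

theorem IsDirCycle.maxCycleLength_toSubdigraph_le (hc : D.IsDirCycle c) :
    hc.toSubdigraph.toDigraph.maxCycleLength ≤ n + 1 := by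
  refine maxCycleLength_le_card.trans ?_
  classical
  rw [Fintype.card_coe]
  simpa [toSubdigraph] using (Finset.card_image_le (s := Finset.univ) (f := c))

/-- On a cycle with constant weight `r`, the all-ones vector is an eigenvector for `r`. -/
theorem IsDirCycle.le_perronRoot_toSubdigraph (hc : D.IsDirCycle c) (S : D.Weighting) {r : ℝ≥0}
    (hr : ∀ i, S.weight (c i) (c (i + 1)) = r) :
    (r : ℝ) ≤ (hc.toSubdigraph.restrict S).perronRoot := by
  classical
  have h := (hc.toSubdigraph.restrict S).le_perronRoot (μ := ((r : ℝ) : ℂ)) (x := fun _ => 1)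
    (fun h => one_ne_zero (congrFun h ⟨c 0, hc.mem_toSubdigraph 0⟩)) (by
      ext ⟨v, hv⟩
      obtain ⟨i, rfl⟩ : ∃ i, c i = v := by simpa [toSubdigraph] using hv
      simp only [Matrix.mulVec, dotProduct, Weighting.adjMatrix, Matrix.of_apply, mul_one,
        Pi.smul_apply, smul_eq_mul]
      rw [Finset.sum_eq_single ⟨c (i + 1), hc.mem_toSubdigraph _⟩]
      · have : hc.toSubdigraph.Adj (c i) (c (i + 1)) := ⟨i, rfl, rfl⟩
        simp [FiniteSubdigraph.restrict, this, hr]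
      · rintro ⟨w, hw⟩ - hne
        have : ¬ hc.toSubdigraph.Adj (c i) w := by
          rintro ⟨j, hj, rfl⟩
          exact hne (Subtype.ext (congrArg (fun k => c (k + 1)) (hc.1 hj)))
        simp [FiniteSubdigraph.restrict, this]
      · simp)
  simpa using h

end CycleSubdigraph

/-- Without a finite cycle transversal, some truthly substochastic weighting has cycles of
arbitrarily small gap. -/
theorem exists_weighting_gap_lt {V : Type*} [Countable V] {D : Digraph V}
    (h : ¬ ∃ T : Set V, T.Finite ∧ D.IsCycleTransversal T) :
    ∃ S : D.Weighting, S.TruthlySubstochastic ∧ ∀ ε : ℝ, 0 < ε →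
      ∃ F : D.FiniteSubdigraph, (F.toDigraph.Strong ∧ ¬ F.toDigraph.Acyclic) ∧ F.gap S < ε := by
  obtain ⟨n, c, hc, hinj⟩ := exists_disjoint_cycles h
  have : Nonempty V := ⟨c 0 0⟩
  -- Chosen so that length times `δ i` is `1 / (i + 2)`; the `2` keeps `δ i` below `1` even for a
  -- loop at `i = 0`.
  let δ : ℕ → ℝ≥0 := fun i => 1 / ((i + 2) * (n i + 1))
  have hδ0 : ∀ i, 0 < δ i := fun i => by positivity
  have hδ1 : ∀ i, δ i < 1 := fun i => by
    rw [div_lt_one (by positivity)]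
    exact_mod_cast (show 1 < (i + 2) * (n i + 1) by nlinarith)
  let C : (Σ i, Fin (n i + 1)) → V := fun p => c p.1 p.2
  have hd : ∀ p, Function.extend C (fun p => δ p.1) (fun _ => 1 / 2) (C p) = δ p.1 :=
    fun p => hinj.extend_apply _ _ p
  have hdcases : ∀ P : ℝ≥0 → Prop, (∀ i, P (δ i)) → P (1 / 2) → ∀ v,
      P (Function.extend C (fun p => δ p.1) (fun _ => 1 / 2) v) := by
    intro P h₁ h₂ v
    by_cases hv : ∃ p, C p = v
    · obtain ⟨p, rfl⟩ := hv
      rw [hd]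
      exact h₁ _
    · rwa [Function.extend_apply' _ _ _ hv]
  obtain ⟨S, hS, hSw⟩ := exists_weighting_of_preferred (D := D)
    (N := fun v w => ∃ p : Σ i, Fin (n i + 1), C p = v ∧ c p.1 (p.2 + 1) = w)
    (by
      rintro _ _ ⟨p, rfl, rfl⟩
      exact (hc p.1).2 p.2)
    (by
      rintro _ _ _ ⟨p, rfl, rfl⟩ ⟨p', hp, rfl⟩
      rw [hinj hp])
    (hdcases (fun t => 0 < t) hδ0 (by norm_num))
    (hdcases (fun t => t < 1) hδ1 (by rw [div_lt_one] <;> norm_num))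
  refine ⟨S, hS, fun ε hε => ?_⟩
  obtain ⟨i, hi⟩ := exists_nat_one_div_lt hε
  refine ⟨(hc i).toSubdigraph, ⟨(hc i).strong_toSubdigraph, (hc i).not_acyclic_toSubdigraph⟩, ?_⟩
  have hroot := (hc i).le_perronRoot_toSubdigraph S (r := 1 - δ i) fun j => by
    rw [hSw _ _ ⟨⟨i, j⟩, rfl, rfl⟩, hd ⟨i, j⟩]
  rw [NNReal.coe_sub (hδ1 i).le, NNReal.coe_one] at hroot
  have hlen : ((hc i).toSubdigraph.toDigraph.maxCycleLength : ℝ) ≤ n i + 1 := by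
    exact_mod_cast (hc i).maxCycleLength_toSubdigraph_le
  calc (hc i).toSubdigraph.gap S
      ≤ (hc i).toSubdigraph.toDigraph.maxCycleLength * (δ i : ℝ) :=
        mul_le_mul_of_nonneg_left (by linarith) (by positivity)
    _ ≤ (n i + 1) * (δ i : ℝ) := mul_le_mul_of_nonneg_right hlen (NNReal.coe_nonneg _)
    _ = 1 / (i + 2) := by
      simp only [δ]
      push_cast
      field_simp
    _ ≤ 1 / (i + 1) := one_div_le_one_div_of_le (by positivity) (by linarith)
    _ < ε := hi

end Digraph

theorem proposition3 {V : Type*} [Countable V] (D : Digraph V) (hD : D.Strong) :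
    ((∀ S : D.Weighting, S.TruthlySubstochastic →
        (0 : EReal) < ⨅ (F : D.FiniteSubdigraph) (_ : ¬ F.toDigraph.Acyclic), (F.gap S : EReal)) ↔
      ∃ T : Set V, T.Finite ∧ D.IsCycleTransversal T) ∧
    ((∀ S : D.Weighting, S.TruthlySubstochastic →
        (0 : EReal) < ⨅ (F : D.FiniteSubdigraph)
          (_ : F.toDigraph.Strong ∧ ¬ F.toDigraph.Acyclic), (F.gap S : EReal)) ↔
      ∃ T : Set V, T.Finite ∧ D.IsCycleTransversal T) := by
  -- Thus the lower bound is needed only for all `F`, and the small gaps only for strong `F`.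
  have hmono : ∀ S : D.Weighting,
      (⨅ (F : D.FiniteSubdigraph) (_ : ¬ F.toDigraph.Acyclic), (F.gap S : EReal)) ≤
        ⨅ (F : D.FiniteSubdigraph) (_ : F.toDigraph.Strong ∧ ¬ F.toDigraph.Acyclic),
          (F.gap S : EReal) :=
    fun S => le_iInf₂ fun F hF => iInf₂_le F hF.2
  have hpos : (∃ T : Set V, T.Finite ∧ D.IsCycleTransversal T) →
      ∀ S : D.Weighting, S.TruthlySubstochastic →
        (0 : EReal) < ⨅ (F : D.FiniteSubdigraph) (_ : ¬ F.toDigraph.Acyclic),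
          (F.gap S : EReal) := by
    rintro ⟨T, hTfin, hT⟩ S hS
    obtain ⟨c, hc, hle⟩ := Digraph.FiniteSubdigraph.exists_pos_le_gap hS hD hTfin hT
    exact lt_of_lt_of_le (EReal.coe_pos.2 hc) (le_iInf₂ fun F hF => EReal.coe_le_coe (hle F hF))
  have htrans : (∀ S : D.Weighting, S.TruthlySubstochastic →
        (0 : EReal) < ⨅ (F : D.FiniteSubdigraph)
          (_ : F.toDigraph.Strong ∧ ¬ F.toDigraph.Acyclic), (F.gap S : EReal)) →
      ∃ T : Set V, T.Finite ∧ D.IsCycleTransversal T := by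
    intro h
    by_contra hcon
    obtain ⟨S, hS, hsmall⟩ := Digraph.exists_weighting_gap_lt hcon
    obtain ⟨ε, hε0, hε⟩ := EReal.lt_iff_exists_real_btwn.1 (h S hS)
    obtain ⟨F, hF, hgap⟩ := hsmall ε (EReal.coe_pos.1 hε0)
    exact absurd (hε.trans_le (iInf₂_le F hF)) (not_lt.2 (EReal.coe_le_coe hgap.le))
  exact ⟨⟨fun h => htrans fun S hS => (h S hS).trans_le (hmono S), hpos⟩,
    ⟨htrans, fun hT S hS => (hpos hT S hS).trans_le (hmono S)⟩⟩
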